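/- Fix a complex number $q$ of modulus one which is not a root of unity, a square root $q^{1/2}$ of $q$, and a real number $\mu\neq 0$. Let ${\cal A}=SL_q(2,\mathbf R)$ be the $*$-Hopf algebra over $\mathbf C$ generated by four real elements $a,b,c,d$ (i.e. $a^*=a$, $b^*=b$, $c^*=c$, $d^*=d$) with relations $$ab=q\,ba,\quad ac=q\,ca,\quad bc=cb,\quad bd=q\,db,\quad cd=q\,dc,\quad da-q^{-1}bc=1=ad-q\,bc,$$ and with $$\Delta\begin{pmatrix}a&b\\c&d\end{pmatrix}=\begin{pmatrix}a&b\\c&d\end{pmatrix}\otimes\begin{pmatrix}a&b\\c&d\end{pmatrix},\quad \varepsilon\begin{pmatrix}a&b\\c&d\end{pmatrix}=\begin{pmatrix}1&0\\0&1\end{pmatrix},\quad S\begin{pmatrix}a&b\\c&d\end{pmatrix}=\begin{pmatrix}d&-q^{-1}b\\-q\,c&a\end{pmatrix}.$$ Put $\tau=*\circ S$. The linear span ${\cal C}$ of $a-d+2q^{1/2}\mu\,b$ and $q\mu^2\,b+c$ is a $\tau$-invariant two-sided coideal of ${\cal A}$; let ${\bf R}_q={\cal A}/({\cal C}{\cal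 A})$ be the quotient by the right ideal generated by ${\cal C}$, with quotient map $r$. It carries the induced coalgebra structure, the induced right ${\cal A}$-action $r(x)\cdot y=r(xy)$ and the induced antilinear map $\tau$, $\tau(r(x))=r(\tau(x))$. For $n\in{\bf N}=\{0,1,2,\dots\}$ let $$v_n=r\big((a+q^{1/2}\mu\,b)(a+q^{3/2}\mu\,b)\cdots(a+q^{n-1/2}\mu\,b)\big),\qquad v_0=r(1),$$ where $q^{k/2}:=(q^{1/2})^k$, and for $n\ge 1$ let $$X_n=\sum_{i=1}^n\frac{(q-q^{-1})^{i-1}\,q^{i/2}\,\mu^i\,[n-1]_q!}{[i]_q\,[n-i]_q!}\;v_{n-i}\cdot b^i,$$ where $[k]_q=(q^k-q^{-k})/(q-q^{-1})$ and $[k]_q!=[1]_q[2]_q\cdots[k]_q$, $[0]_q!=1$. Then every $v_n$ ($n\in{\bf N}$) is group-like, i.e. $\Delta v_n=v_n\otimes v_n$ and $\varepsilon(v_n)=1$; for every $n\geq 1$ $$\Delta X_n=X_n\otimes v_n+v_n\otimes X_n,\qquad \tau(X_n)=-X_n;$$ and the elements $v_n$ ($n\in{\bf N}$) together with the $X_n$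 ($n\geq 1$) form a linear basis of ${\bf R}_q$. -/

import Mathlib

open scoped TensorProduct

noncomputable section

/-- The names of the four generators. -/
inductive SLqGen : Type
  | a | b | c | d

/-- The defining relations of the function algebra on the quantum group `SL_q(2, ℝ)`. -/
inductive SLqRel (q : ℂ) : FreeAlgebra ℂ SLqGen → FreeAlgebra ℂ SLqGen → Prop
  | ab : SLqRel q (FreeAlgebra.ι ℂ .a * FreeAlgebra.ι ℂ .b)
      (q • (FreeAlgebra.ι ℂ .b * FreeAlgebra.ι ℂ .a))
  | ac : SLqRel q (FreeAlgebra.ι ℂ .a * FreeAlgebra.ι ℂ .c)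
      (q • (FreeAlgebra.ι ℂ .c * FreeAlgebra.ι ℂ .a))
  | bc : SLqRel q (FreeAlgebra.ι ℂ .b * FreeAlgebra.ι ℂ .c)
      (FreeAlgebra.ι ℂ .c * FreeAlgebra.ι ℂ .b)
  | bd : SLqRel q (FreeAlgebra.ι ℂ .b * FreeAlgebra.ι ℂ .d)
      (q • (FreeAlgebra.ι ℂ .d * FreeAlgebra.ι ℂ .b))
  | cd : SLqRel q (FreeAlgebra.ι ℂ .c * FreeAlgebra.ι ℂ .d)
      (q • (FreeAlgebra.ι ℂ .d * FreeAlgebra.ι ℂ .c))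
  | da : SLqRel q (FreeAlgebra.ι ℂ .d * FreeAlgebra.ι ℂ .a
      - q⁻¹ • (FreeAlgebra.ι ℂ .b * FreeAlgebra.ι ℂ .c)) 1
  | ad : SLqRel q (FreeAlgebra.ι ℂ .a * FreeAlgebra.ι ℂ .d
      - q • (FreeAlgebra.ι ℂ .b * FreeAlgebra.ι ℂ .c)) 1

/-- The function algebra on the quantum group `SL_q(2, ℝ)`, for `q` of modulus one. -/
def SLq (q : Circle) : Type := RingQuot (SLqRel (q : ℂ))

namespace SLq

instance (q : Circle) : Ring (SLq q) := inferInstanceAs (Ring (RingQuot _))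
instance (q : Circle) : Algebra ℂ (SLq q) := inferInstanceAs (Algebra ℂ (RingQuot _))

/-- The quotient map from the free algebra. -/
def mk (q : Circle) : FreeAlgebra ℂ SLqGen →ₐ[ℂ] SLq q :=
  RingQuot.mkAlgHom ℂ (SLqRel (q : ℂ))

/-- The generator `a`. -/
def a (q : Circle) : SLq q := mk q (FreeAlgebra.ι ℂ .a)
/-- The generator `b`. -/
def b (q : Circle) : SLq q := mk q (FreeAlgebra.ι ℂ .b)
/-- The generator `c`. -/
def c (q : Circle) : SLq q := mk q (FreeAlgebra.ι ℂ .c)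
/-- The generator `d`. -/
def d (q : Circle) : SLq q := mk q (FreeAlgebra.ι ℂ .d)

variable (q : Circle)

theorem mk_rel {x y : FreeAlgebra ℂ SLqGen} (h : SLqRel (q : ℂ) x y) : mk q x = mk q y :=
  RingQuot.mkAlgHom_rel ℂ h

theorem a_mul_b : a q * b q = (q : ℂ) • (b q * a q) := by
  simpa [a, b] using mk_rel q SLqRel.ab
theorem a_mul_c : a q * c q = (q : ℂ) • (c q * a q) := by
  simpa [a, c] using mk_rel q SLqRel.ac
theorem b_mul_c : b q * c q = c q * b q := by
  simpa [b, c] using mk_rel q SLqRel.bc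
theorem b_mul_d : b q * d q = (q : ℂ) • (d q * b q) := by
  simpa [b, d] using mk_rel q SLqRel.bd
theorem c_mul_d : c q * d q = (q : ℂ) • (d q * c q) := by
  simpa [c, d] using mk_rel q SLqRel.cd
theorem d_mul_a' : d q * a q - (q : ℂ)⁻¹ • (b q * c q) = 1 := by
  simpa [a, b, c, d, -Circle.coe_inv, -map_inv₀] using mk_rel q SLqRel.da
theorem a_mul_d' : a q * d q - (q : ℂ) • (b q * c q) = 1 := by
  simpa [a, b, c, d] using mk_rel q SLqRel.ad
theorem d_mul_a : d q * a q = 1 + (q : ℂ)⁻¹ • (b q * c q) :=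
  sub_eq_iff_eq_add.1 (d_mul_a' q)
theorem a_mul_d : a q * d q = 1 + (q : ℂ) • (b q * c q) :=
  sub_eq_iff_eq_add.1 (a_mul_d' q)

theorem induction {P : SLq q → Prop} (hz : ∀ z : ℂ, P (algebraMap ℂ _ z))
    (ha : P (a q)) (hb : P (b q)) (hc : P (c q)) (hd : P (d q))
    (hadd : ∀ x y, P x → P y → P (x + y)) (hmul : ∀ x y, P x → P y → P (x * y))
    (x : SLq q) : P x := by
  obtain ⟨y, rfl⟩ : ∃ y, mk q y = x := RingQuot.mkAlgHom_surjective ℂ _ x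
  induction y using FreeAlgebra.induction with
  | grade0 z => simpa using hz z
  | grade1 g => cases g <;> assumption
  | mul x y hx hy => simpa using hmul _ _ hx hy
  | add x y hx hy => simpa using hadd _ _ hx hy

theorem b_mul_a : b q * a q = (q : ℂ)⁻¹ • (a q * b q) := by
  rw [a_mul_b, smul_smul, inv_mul_cancel₀ q.coe_ne_zero, one_smul]
theorem c_mul_a : c q * a q = (q : ℂ)⁻¹ • (a q * c q) := by
  rw [a_mul_c, smul_smul, inv_mul_cancel₀ q.coe_ne_zero, one_smul]
theorem d_mul_b : d q * b q = (q : ℂ)⁻¹ • (b q * d q) := by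
  rw [b_mul_d, smul_smul, inv_mul_cancel₀ q.coe_ne_zero, one_smul]
theorem d_mul_c : d q * c q = (q : ℂ)⁻¹ • (c q * d q) := by
  rw [c_mul_d, smul_smul, inv_mul_cancel₀ q.coe_ne_zero, one_smul]

/-- Four elements of an algebra satisfy the defining relations. -/
structure Rels {B : Type} [Ring B] [Algebra ℂ B] (a' b' c' d' : B) : Prop where
  ab : a' * b' = (q : ℂ) • (b' * a')
  ac : a' * c' = (q : ℂ) • (c' * a')
  bc : b' * c' = c' * b'
  bd : b' * d' = (q : ℂ) • (d' * b')
  cd : c' * d' = (q : ℂ) • (d' * c')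
  da : d' * a' - (q : ℂ)⁻¹ • (b' * c') = 1
  ad : a' * d' - (q : ℂ) • (b' * c') = 1

/-- The images of the generators under a homomorphism. -/
def genMap {B : Type} (a' b' c' d' : B) : SLqGen → B
  | .a => a'
  | .b => b'
  | .c => c'
  | .d => d'

/-- The universal property: four elements of an algebra which satisfy the relations define a
homomorphism. -/
def lift {B : Type} [Ring B] [Algebra ℂ B] (a' b' c' d' : B) (h : Rels q a' b' c' d') :
    SLq q →ₐ[ℂ] B :=
  RingQuot.liftAlgHom ℂ ⟨FreeAlgebra.lift ℂ (genMap a' b' c' d'), by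
    intro x y hxy
    obtain ⟨h1, h2, h3, h4, h5, h6, h7⟩ := h
    cases hxy <;> simpa [genMap, -Circle.coe_inv, -map_inv₀]⟩

section lift
variable {B : Type} [Ring B] [Algebra ℂ B] {a' b' c' d' : B} {h : Rels q a' b' c' d'}

theorem lift_mk (x : FreeAlgebra ℂ SLqGen) :
    lift q a' b' c' d' h (mk q x) = FreeAlgebra.lift ℂ (genMap a' b' c' d') x :=
  RingQuot.liftAlgHom_mkAlgHom_apply ℂ _ _ _

@[simp] theorem lift_a : lift q a' b' c' d' h (a q) = a' := by
  rw [a, lift_mk]; simp [genMap]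
@[simp] theorem lift_b : lift q a' b' c' d' h (b q) = b' := by
  rw [b, lift_mk]; simp [genMap]
@[simp] theorem lift_c : lift q a' b' c' d' h (c q) = c' := by
  rw [c, lift_mk]; simp [genMap]
@[simp] theorem lift_d : lift q a' b' c' d' h (d q) = d' := by
  rw [d, lift_mk]; simp [genMap]
end lift

theorem algHom_ext {B : Type} [Ring B] [Algebra ℂ B] {f g : SLq q →ₐ[ℂ] B}
    (ha : f (a q) = g (a q)) (hb : f (b q) = g (b q)) (hc : f (c q) = g (c q))
    (hd : f (d q) = g (d q)) : f = g := by
  ext x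
  induction x using induction q with
  | hz z => simp
  | ha => exact ha
  | hb => exact hb
  | hc => exact hc
  | hd => exact hd
  | hadd x y hx hy => simp [hx, hy]
  | hmul x y hx hy => simp [hx, hy]

theorem comul_rels : Rels q (a q ⊗ₜ[ℂ] a q + b q ⊗ₜ[ℂ] c q) (a q ⊗ₜ[ℂ] b q + b q ⊗ₜ[ℂ] d q)
    (c q ⊗ₜ[ℂ] a q + d q ⊗ₜ[ℂ] c q) (c q ⊗ₜ[ℂ] b q + d q ⊗ₜ[ℂ] d q) := by
  have hq : (q : ℂ) ≠ 0 := q.coe_ne_zero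
  constructor <;>
  · simp only [add_mul, mul_add, Algebra.TensorProduct.tmul_mul_tmul, b_mul_a, c_mul_a,
      ← b_mul_c, d_mul_b, d_mul_c, d_mul_a, a_mul_d, TensorProduct.add_tmul,
      TensorProduct.tmul_add, ← TensorProduct.smul_tmul', TensorProduct.tmul_smul, smul_smul,
      smul_add, Algebra.TensorProduct.one_def]
    match_scalars <;> field_simp <;> ring

/-- The coproduct: the matrix coproduct on the matrix of generators. -/
def comulHom : SLq q →ₐ[ℂ] SLq q ⊗[ℂ] SLq q :=
  lift q (a q ⊗ₜ a q + b q ⊗ₜ c q) (a q ⊗ₜ b q + b q ⊗ₜ d q)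
    (c q ⊗ₜ a q + d q ⊗ₜ c q) (c q ⊗ₜ b q + d q ⊗ₜ d q) (comul_rels q)

/-- The counit. -/
def counitHom : SLq q →ₐ[ℂ] ℂ :=
  lift q 1 0 0 1 (by constructor <;> simp)

instance : Bialgebra ℂ (SLq q) :=
  Bialgebra.ofAlgHom (comulHom q) (counitHom q)
    (by
      apply algHom_ext <;>
        simp [comulHom, TensorProduct.add_tmul, TensorProduct.tmul_add] <;> abel)
    (by apply algHom_ext <;> simp [comulHom, counitHom])
    (by apply algHom_ext <;> simp [comulHom, counitHom])

theorem comul_def (x : SLq q) : Coalgebra.comul (R := ℂ) x = comulHom q x := rfl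
theorem counit_def (x : SLq q) : Coalgebra.counit (R := ℂ) x = counitHom q x := rfl

theorem antipode_rels : Rels q (MulOpposite.op (d q)) (.op (-((q : ℂ)⁻¹ • b q)))
    (.op (-((q : ℂ) • c q))) (.op (a q)) := by
  have hq : (q : ℂ) ≠ 0 := q.coe_ne_zero
  constructor <;>
  · apply MulOpposite.unop_injective
    simp only [MulOpposite.unop_mul, MulOpposite.unop_sub, MulOpposite.unop_smul,
      MulOpposite.unop_op, MulOpposite.unop_one, neg_mul, mul_neg, smul_mul_assoc,
      mul_smul_comm, b_mul_a, c_mul_a, ← b_mul_c, d_mul_b, d_mul_c, d_mul_a, a_mul_d, smul_smul]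
    match_scalars <;> field_simp <;> ring

/-- The antipode, an antihomomorphism, as a homomorphism to the opposite algebra. -/
def antipodeHom : SLq q →ₐ[ℂ] (SLq q)ᵐᵒᵖ :=
  lift q (.op (d q)) (.op (-((q : ℂ)⁻¹ • b q))) (.op (-((q : ℂ) • c q))) (.op (a q))
    (antipode_rels q)

/-- The antipode as a linear map. -/
def antipodeLin : SLq q →ₗ[ℂ] SLq q :=
  (MulOpposite.opLinearEquiv ℂ).symm.toLinearMap ∘ₗ (antipodeHom q).toLinearMap

theorem antipodeLin_apply (x : SLq q) : antipodeLin q x = (antipodeHom q x).unop := rfl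

theorem antipodeLin_mul (x y : SLq q) :
    antipodeLin q (x * y) = antipodeLin q y * antipodeLin q x := by
  simp [antipodeLin_apply]

theorem antipode_left_mul (U V : SLq q ⊗[ℂ] SLq q) (z : ℂ)
    (hU : LinearMap.mul' ℂ _ ((antipodeLin q).rTensor _ U) = algebraMap ℂ _ z) :
    LinearMap.mul' ℂ _ ((antipodeLin q).rTensor _ (U * V)) =
      z • LinearMap.mul' ℂ _ ((antipodeLin q).rTensor _ V) := by
  induction V with
  | zero => simp
  | add V W hV hW => simp [mul_add, hV, hW]
  | tmul v w =>
    have key : LinearMap.mul' ℂ _ ((antipodeLin q).rTensor _ (U * v ⊗ₜ w)) =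
        antipodeLin q v * LinearMap.mul' ℂ _ ((antipodeLin q).rTensor _ U) * w := by
      clear hU
      induction U with
      | zero => simp
      | add U W hU hW => simp [add_mul, mul_add, hU, hW]
      | tmul x y => simp [antipodeLin_mul, mul_assoc]
    rw [key, hU, ← Algebra.commutes, mul_assoc, Algebra.smul_def]
    simp

theorem antipode_right_mul (U V : SLq q ⊗[ℂ] SLq q) (z : ℂ)
    (hV : LinearMap.mul' ℂ _ ((antipodeLin q).lTensor _ V) = algebraMap ℂ _ z) :
    LinearMap.mul' ℂ _ ((antipodeLin q).lTensor _ (U * V)) =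
      z • LinearMap.mul' ℂ _ ((antipodeLin q).lTensor _ U) := by
  induction U with
  | zero => simp
  | add U W hU hW => simp [add_mul, hU, hW]
  | tmul v w =>
    have key : LinearMap.mul' ℂ _ ((antipodeLin q).lTensor _ (v ⊗ₜ w * V)) =
        v * LinearMap.mul' ℂ _ ((antipodeLin q).lTensor _ V) * antipodeLin q w := by
      clear hV
      induction V with
      | zero => simp
      | add U W hU hW => simp [add_mul, mul_add, hU, hW]
      | tmul x y => simp [antipodeLin_mul, mul_assoc]
    rw [key, hV, ← Algebra.commutes, mul_assoc, Algebra.smul_def]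
    simp

instance : HopfAlgebra ℂ (SLq q) where
  antipode := antipodeLin q
  mul_antipode_rTensor_comul := by
    have hq : (q : ℂ) ≠ 0 := q.coe_ne_zero
    ext x
    simp only [LinearMap.comp_apply, comul_def, counit_def, Algebra.linearMap_apply]
    induction x using induction q with
    | hz z => simp [Algebra.TensorProduct.algebraMap_apply, antipodeLin_apply]
    | hadd x y hx hy => simp [hx, hy]
    | hmul x y hx hy =>
      rw [map_mul, antipode_left_mul q _ _ _ hx, hy, map_mul, map_mul, Algebra.smul_def]
    | _ =>
      simp [comulHom, counitHom, antipodeLin_apply, antipodeHom, -Circle.coe_inv, -map_inv₀]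
      simp only [b_mul_a, c_mul_a, ← b_mul_c, d_mul_b, d_mul_c, d_mul_a, a_mul_d, smul_smul]
      match_scalars <;> field_simp <;> ring
  mul_antipode_lTensor_comul := by
    have hq : (q : ℂ) ≠ 0 := q.coe_ne_zero
    ext x
    simp only [LinearMap.comp_apply, comul_def, counit_def, Algebra.linearMap_apply]
    induction x using induction q with
    | hz z => simp [Algebra.TensorProduct.algebraMap_apply, antipodeLin_apply]
    | hadd x y hx hy => simp [hx, hy]
    | hmul x y hx hy =>
      rw [map_mul, antipode_right_mul q _ _ _ hy, hx, map_mul, map_mul, Algebra.smul_def,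
        Algebra.commutes]
    | _ =>
      simp [comulHom, counitHom, antipodeLin_apply, antipodeHom, -Circle.coe_inv, -map_inv₀]
      simp only [b_mul_a, c_mul_a, ← b_mul_c, d_mul_b, d_mul_c, d_mul_a, a_mul_d, smul_smul]
      match_scalars <;> field_simp <;> ring

/-- The opposite algebra, with complex scalars acting through complex conjugation. -/
def ConjOp : Type := (SLq q)ᵐᵒᵖ

instance : Ring (ConjOp q) := inferInstanceAs (Ring (SLq q)ᵐᵒᵖ)

/-- The identity map to the conjugate opposite algebra. -/
def toConjOp (x : SLq q) : ConjOp q := MulOpposite.op x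

/-- The identity map from the conjugate opposite algebra. -/
def ofConjOp (x : ConjOp q) : SLq q := MulOpposite.unop (α := SLq q) x

instance : Algebra ℂ (ConjOp q) :=
  RingHom.toAlgebra' (S := ConjOp q)
    ((algebraMap ℂ (SLq q)ᵐᵒᵖ : ℂ →+* (SLq q)ᵐᵒᵖ).comp (starRingEnd ℂ))
    fun z x => Algebra.commutes (A := (SLq q)ᵐᵒᵖ) (starRingEnd ℂ z) x

theorem smul_conjOp (z : ℂ) (x : SLq q) :
    z • toConjOp q x = toConjOp q (starRingEnd ℂ z • x) := by
  have h : (algebraMap ℂ (SLq q)ᵐᵒᵖ (starRingEnd ℂ z)) * MulOpposite.op x =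
      MulOpposite.op (starRingEnd ℂ z • x) := by
    rw [← Algebra.smul_def, MulOpposite.op_smul]
  exact h

theorem toConjOp_mul (x y : SLq q) : toConjOp q x * toConjOp q y = toConjOp q (y * x) := rfl
theorem toConjOp_sub (x y : SLq q) : toConjOp q x - toConjOp q y = toConjOp q (x - y) := rfl

theorem star_rels : Rels q (toConjOp q (a q)) (toConjOp q (b q)) (toConjOp q (c q))
    (toConjOp q (d q)) := by
  have hq : (q : ℂ) ≠ 0 := q.coe_ne_zero
  have hs : starRingEnd ℂ (q : ℂ) = (q : ℂ)⁻¹ := (Circle.coe_inv_eq_conj q).symm.trans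
    (Circle.coe_inv q)
  have hs' : starRingEnd ℂ (q : ℂ)⁻¹ = (q : ℂ) := by
    rw [map_inv₀, hs, inv_inv]
  constructor <;>
  · simp only [toConjOp_mul, smul_conjOp, toConjOp_sub, hs, hs']
    apply congrArg (toConjOp q)
    simp only [b_mul_a, c_mul_a, ← b_mul_c, d_mul_b, d_mul_c, d_mul_a, a_mul_d, smul_smul]
    all_goals match_scalars <;> field_simp <;> ring

/-- The antilinear antihomomorphism which fixes the four generators, as a homomorphism to the
conjugate opposite algebra. -/
def starHom : SLq q →ₐ[ℂ] ConjOp q :=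
  lift q (toConjOp q (a q)) (toConjOp q (b q)) (toConjOp q (c q)) (toConjOp q (d q)) (star_rels q)

instance : Star (SLq q) := ⟨fun x => ofConjOp q (starHom q x)⟩

theorem star_def (x : SLq q) : star x = ofConjOp q (starHom q x) := rfl
@[simp] theorem star_a : star (a q) = a q := by simp [star_def, starHom]; rfl
@[simp] theorem star_b : star (b q) = b q := by simp [star_def, starHom]; rfl
@[simp] theorem star_c : star (c q) = c q := by simp [star_def, starHom]; rfl
@[simp] theorem star_d : star (d q) = d q := by simp [star_def, starHom]; rfl

theorem star_mul_aux (x y : SLq q) : star (x * y) = star y * star x := by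
  simp only [star_def, map_mul]; rfl

theorem star_add_aux (x y : SLq q) : star (x + y) = star x + star y := by
  simp only [star_def, map_add]; rfl

theorem star_algebraMap (z : ℂ) :
    star (algebraMap ℂ (SLq q) z) = algebraMap ℂ (SLq q) (starRingEnd ℂ z) := by
  simp only [star_def, AlgHom.commutes]; rfl

/-- The `*`-structure for which the four generators are real. -/
instance : StarRing (SLq q) where
  star_mul := star_mul_aux q
  star_add := star_add_aux q
  star_involutive x := by
    induction x using induction q with
    | hz z => simp only [star_algebraMap, Complex.conj_conj]
    | hadd x y hx hy => simp only [star_add_aux, hx, hy]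
    | hmul x y hx hy => simp only [star_mul_aux, hx, hy]
    | _ => simp

instance : StarModule ℂ (SLq q) where
  star_smul z x := by
    rw [Algebra.smul_def, star_mul, star_algebraMap, ← Algebra.commutes, ← Algebra.smul_def]
    rfl

/-- The antilinear map `τ = * ∘ S`. -/
def tau : SLq q →ₛₗ[starRingEnd ℂ] SLq q where
  toFun x := star (HopfAlgebra.antipode ℂ x)
  map_add' x y := by simp
  map_smul' z x := by simp

theorem tau_apply (x : SLq q) : tau q x = star (antipodeLin q x) := rfl

theorem tau_mul (x y : SLq q) : tau q (x * y) = tau q x * tau q y := by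
  simp [tau_apply, antipodeLin_mul]

theorem tau_a : tau q (a q) = d q := by
  simp [tau_apply, antipodeLin_apply, antipodeHom]
theorem tau_d : tau q (d q) = a q := by
  simp [tau_apply, antipodeLin_apply, antipodeHom]
theorem tau_b : tau q (b q) = -((q : ℂ) • b q) := by
  have hs : starRingEnd ℂ (q : ℂ)⁻¹ = (q : ℂ) := by
    rw [map_inv₀, ← Circle.coe_inv_eq_conj, Circle.coe_inv, inv_inv]
  simp [tau_apply, antipodeLin_apply, antipodeHom, star_smul, -Circle.coe_inv, -map_inv₀,
    -star_inv₀, hs]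
theorem tau_c : tau q (c q) = -((q : ℂ)⁻¹ • c q) := by
  have hs : starRingEnd ℂ (q : ℂ) = (q : ℂ)⁻¹ := (Circle.coe_inv_eq_conj q).symm.trans
    (Circle.coe_inv q)
  simp [tau_apply, antipodeLin_apply, antipodeHom, star_smul, -Circle.coe_inv, hs]

/-! Here `p` is the fixed square root of `q`, so that `q = p ^ 2`. -/

variable (p : Circle) (μ ν : ℝ)

/-- The generator `a - d + 2 q^(1/2) μ b` of the coideal. -/
def genX : SLq (p ^ 2) := a _ - d _ + (2 * (p : ℂ) * μ) • b _

/-- The generator `q ν b + c` of the coideal. -/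
def genY : SLq (p ^ 2) := ((p : ℂ) ^ 2 * ν) • b _ + c _

/-- The two-sided coideal spanned by `a - d + 2 q^(1/2) μ b` and `q ν b + c`. -/
def coideal : Submodule ℂ (SLq (p ^ 2)) := Submodule.span ℂ {genX p μ, genY p ν}

/-- The right ideal generated by the coideal. -/
def rightIdeal : Submodule ℂ (SLq (p ^ 2)) := coideal p μ ν * ⊤

theorem mul_mem_rightIdeal {x : SLq (p ^ 2)} (hx : x ∈ rightIdeal p μ ν) (y : SLq (p ^ 2)) :
    x * y ∈ rightIdeal p μ ν := by
  have h : x * y ∈ coideal p μ ν * ⊤ * ⊤ := Submodule.mul_mem_mul hx Submodule.mem_top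
  rw [mul_assoc] at h
  exact Submodule.mul_le.2 (fun m hm n _ => Submodule.mul_mem_mul hm Submodule.mem_top) h

theorem genX_mem : genX p μ ∈ coideal p μ ν := Submodule.subset_span (by simp)
theorem genY_mem : genY p ν ∈ coideal p μ ν := Submodule.subset_span (by simp)

theorem comul_genX : comulHom _ (genX p μ) =
    genX p μ ⊗ₜ (a _ + (2 * (p : ℂ) * μ) • b _) + (d _ - (2 * (p : ℂ) * μ) • b _) ⊗ₜ genX p μ
      + b _ ⊗ₜ genY p ν - genY p ν ⊗ₜ b _ := by
  simp only [genX, genY, map_add, map_sub, map_smul, comulHom, lift_a, lift_b, lift_c, lift_d,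
    TensorProduct.add_tmul, TensorProduct.tmul_add, TensorProduct.sub_tmul,
    TensorProduct.tmul_sub, ← TensorProduct.smul_tmul', TensorProduct.tmul_smul]
  module

theorem comul_genY : comulHom _ (genY p ν) =
    (a _ + (2 * (p : ℂ) * μ) • b _) ⊗ₜ genY p ν + genY p ν ⊗ₜ (d _ - (2 * (p : ℂ) * μ) • b _)
      - genX p μ ⊗ₜ c _ + c _ ⊗ₜ genX p μ := by
  simp only [genX, genY, map_add, map_sub, map_smul, comulHom, lift_a, lift_b, lift_c, lift_d,
    TensorProduct.add_tmul, TensorProduct.tmul_add, TensorProduct.sub_tmul,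
    TensorProduct.tmul_sub, ← TensorProduct.smul_tmul', TensorProduct.tmul_smul]
  module

theorem map_mkQ_tmul_mul {I : Submodule ℂ (SLq q)} {x y : SLq q}
    (h : (∀ z, x * z ∈ I) ∨ ∀ z, y * z ∈ I) (T : SLq q ⊗[ℂ] SLq q) :
    TensorProduct.map I.mkQ I.mkQ (x ⊗ₜ y * T) = 0 := by
  induction T with
  | zero => simp
  | add T U hT hU => rw [mul_add, map_add, hT, hU, add_zero]
  | tmul u v =>
    rw [Algebra.TensorProduct.tmul_mul_tmul, TensorProduct.map_tmul]
    rcases h with h | h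
    · rw [I.mkQ_apply (x * u), (Submodule.Quotient.mk_eq_zero I).2 (h u), TensorProduct.zero_tmul]
    · rw [I.mkQ_apply (y * v), (Submodule.Quotient.mk_eq_zero I).2 (h v), TensorProduct.tmul_zero]

instance : (rightIdeal p μ ν).IsCoideal where
  counit_eq_zero x hx := by
    rw [counit_def]
    induction hx using Submodule.mul_induction_on' with
    | add x _ y _ hx hy => rw [map_add, hx, hy, add_zero]
    | mem_mul_mem m hm n _ =>
      rw [map_mul]
      have : counitHom _ m = 0 := by
        induction hm using Submodule.span_induction with
        | mem x hx => rcases hx with rfl | rfl <;> simp [genX, genY, counitHom]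
        | zero => simp
        | add x y _ _ hx hy => simp [hx, hy]
        | smul z x _ hx => simp [hx]
      rw [this, zero_mul]
  map_mkQ_comul_eq_zero x hx := by
    rw [comul_def]
    have hX : ∀ z, genX p μ * z ∈ rightIdeal p μ ν := fun z =>
      Submodule.mul_mem_mul (genX_mem p μ ν) Submodule.mem_top
    have hY : ∀ z, genY p ν * z ∈ rightIdeal p μ ν := fun z =>
      Submodule.mul_mem_mul (genY_mem p μ ν) Submodule.mem_top
    induction hx using Submodule.mul_induction_on' with
    | add x _ y _ hx hy => rw [map_add, map_add, hx, hy, add_zero]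
    | mem_mul_mem m hm n _ =>
      rw [map_mul]
      generalize comulHom _ n = T
      induction hm using Submodule.span_induction with
      | mem x hx =>
        rcases hx with rfl | rfl
        · rw [comul_genX p μ ν]
          simp only [add_mul, sub_mul, map_add, map_sub, map_mkQ_tmul_mul _ (Or.inl hX),
            map_mkQ_tmul_mul _ (Or.inr hX), map_mkQ_tmul_mul _ (Or.inl hY),
            map_mkQ_tmul_mul _ (Or.inr hY), add_zero, sub_zero]
        · rw [comul_genY p μ ν]
          simp only [add_mul, sub_mul, map_add, map_sub, map_mkQ_tmul_mul _ (Or.inl hX),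
            map_mkQ_tmul_mul _ (Or.inr hX), map_mkQ_tmul_mul _ (Or.inl hY),
            map_mkQ_tmul_mul _ (Or.inr hY), add_zero, sub_zero]
      | zero => simp
      | add x y _ _ hx hy => rw [map_add, add_mul, map_add, hx, hy, add_zero]
      | smul z x _ hx => rw [map_smul, smul_mul_assoc, map_smul, hx, smul_zero]

theorem tau_genX : tau _ (genX p μ) = -genX p μ := by
  have hp : (p : ℂ) ≠ 0 := p.coe_ne_zero
  have hs : starRingEnd ℂ (p : ℂ) = (p : ℂ)⁻¹ := (Circle.coe_inv_eq_conj p).symm.trans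
    (Circle.coe_inv p)
  simp only [genX, map_add, map_sub, LinearMap.map_smulₛₗ, tau_a, tau_b, tau_d, map_mul, hs,
    Complex.conj_ofReal, map_ofNat, Circle.coe_pow]
  match_scalars <;> field_simp

theorem tau_genY : tau _ (genY p ν) = -(((p : ℂ) ^ 2)⁻¹ • genY p ν) := by
  have hp : (p : ℂ) ≠ 0 := p.coe_ne_zero
  have hs : starRingEnd ℂ (p : ℂ) = (p : ℂ)⁻¹ := (Circle.coe_inv_eq_conj p).symm.trans
    (Circle.coe_inv p)
  simp only [genY, map_add, LinearMap.map_smulₛₗ, tau_b, tau_c, map_mul, map_pow, hs,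
    Complex.conj_ofReal, Circle.coe_pow]
  match_scalars <;> field_simp

theorem rightIdeal_le_comap_tau :
    rightIdeal p μ ν ≤ (rightIdeal p μ ν).comap (tau (p ^ 2)) := by
  refine Submodule.mul_le.2 fun m hm n _ => ?_
  rw [Submodule.mem_comap, tau_mul]
  refine Submodule.mul_mem_mul ?_ Submodule.mem_top
  induction hm using Submodule.span_induction with
  | mem x hx =>
    rcases hx with rfl | rfl
    · rw [tau_genX]
      exact neg_mem (genX_mem p μ ν)
    · rw [tau_genY]
      exact neg_mem (Submodule.smul_mem _ _ (genY_mem p μ ν))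
  | zero => simp
  | add x y _ _ hx hy => rw [map_add]; exact add_mem hx hy
  | smul z x _ hx => rw [LinearMap.map_smulₛₗ]; exact Submodule.smul_mem _ _ hx

end SLq

open SLq

/-- The right coisotropic quantum subgroup `K_{μν}`, the quotient of `SL_q(2, ℝ)`, `q = p ^ 2`, by
the right ideal generated by `a - d + 2 q^(1/2) μ b` and `q ν b + c`, with `q^(1/2) = p`.
Its coalgebra structure is that of the quotient by a coideal. -/
abbrev CoisoK (p : Circle) (μ ν : ℝ) : Type := SLq (p ^ 2) ⧸ rightIdeal p μ ν

namespace CoisoK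

variable (p : Circle) (μ ν : ℝ)

/-- The quotient map `r_{μν}`. -/
def proj : SLq (p ^ 2) →ₗ[ℂ] CoisoK p μ ν := (rightIdeal p μ ν).mkQ

/-- The right action of `x`: it sends `r[y]` to `r[y] · x = r[y x]`. -/
def act (x : SLq (p ^ 2)) : CoisoK p μ ν →ₗ[ℂ] CoisoK p μ ν :=
  (rightIdeal p μ ν).mapQ (rightIdeal p μ ν) (LinearMap.mulRight ℂ x)
    fun _ hy => mul_mem_rightIdeal p μ ν hy x

/-- The antilinear map induced by `τ = * ∘ S`: it sends `r[x]` to `r[τ x]`. -/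
def tau : CoisoK p μ ν →ₛₗ[starRingEnd ℂ] CoisoK p μ ν :=
  (rightIdeal p μ ν).mapQ (rightIdeal p μ ν) (SLq.tau (p ^ 2)) (rightIdeal_le_comap_tau p μ ν)

theorem tau_proj (x : SLq (p ^ 2)) :
    tau p μ ν (proj p μ ν x) = proj p μ ν (SLq.tau _ x) := rfl

theorem act_proj (x y : SLq (p ^ 2)) :
    act p μ ν x (proj p μ ν y) = proj p μ ν (y * x) := rfl

theorem comul_proj (x : SLq (p ^ 2)) :
    Coalgebra.comul (R := ℂ) (proj p μ ν x) =
      TensorProduct.map (proj p μ ν) (proj p μ ν) (Coalgebra.comul x) := rfl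

theorem counit_proj (x : SLq (p ^ 2)) :
    Coalgebra.counit (R := ℂ) (proj p μ ν x) = Coalgebra.counit (R := ℂ) x := rfl

end CoisoK

/-- The coalgebra `R_q`, which is `K_{μν}` for `ν = μ ^ 2`. -/
abbrev Rq (p : Circle) (μ : ℝ) : Type := CoisoK p μ (μ ^ 2)

namespace Rq

variable (p : Circle) (μ : ℝ)

/-- `w_n = (a + q^(1/2) μ b) (a + q^(3/2) μ b) ⋯ (a + q^(n - 1/2) μ b)`, where `q^(1/2) = p`. -/
def w : ℕ → SLq (p ^ 2)
  | 0 => 1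
  | n + 1 => w n * (a _ + ((p : ℂ) ^ (2 * n + 1) * μ) • b _)

/-- The element `v_n` of `R_q`, the class of `w_n`. -/
def v (n : ℕ) : Rq p μ := CoisoK.proj p μ (μ ^ 2) (w p μ n)

/-- The `q`-number `[n]_q = (q^n - q^(-n)) / (q - q^(-1))`. -/
def qNum (q : ℂ) (n : ℕ) : ℂ := (q ^ n - (q ^ n)⁻¹) / (q - q⁻¹)

/-- The `q`-factorial `[n]_q! = [1]_q [2]_q ⋯ [n]_q`. -/
def qFact (q : ℂ) (n : ℕ) : ℂ := ∏ i ∈ Finset.Icc 1 n, qNum q i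

/-- The element
`X_n = ∑_{i=1}^n (q - q⁻¹)^(i-1) q^(i/2) μ^i [n-1]_q! / ([i]_q [n-i]_q!) v_{n-i} · b^i`
of `R_q`, where `q = p ^ 2` and `q^(1/2) = p`; it is used for `n ≥ 1`. -/
def X (n : ℕ) : Rq p μ :=
  ∑ i ∈ Finset.Icc 1 n,
    (((p : ℂ) ^ 2 - ((p : ℂ) ^ 2)⁻¹) ^ (i - 1) * (p : ℂ) ^ i * (μ : ℂ) ^ i *
        qFact ((p : ℂ) ^ 2) (n - 1) / (qNum ((p : ℂ) ^ 2) i * qFact ((p : ℂ) ^ 2) (n - i))) •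
      CoisoK.act p μ (μ ^ 2) (b (p ^ 2) ^ i) (v p μ (n - i))

end Rq

end

/-!
The class `r(1)` is a character: on it `c` acts as `-(β γ) b` and `d` as `a + (β + γ) b`, where the
weight `(β, γ)` is determined up to order by `β + γ = 2 q^(1/2) μ` and `β γ = q μ^2`. Acting by
`a + β b` turns a character of weight `(β, γ)` into one of weight `(q β, q⁻¹ γ)` and preserves both
group-likeness and, when `β* = q⁻¹ γ`, invariance under `τ`; starting from `r(1)` this yields the
`v_n`. For `r(1)` the two weights coincide, so that `r(1)` stays a character to first order when
they are moved apart to `β (1 + ε)` and `γ (1 - ε)`, `ε ^ 2 = 0`. Differentiating the recursion of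
the `v_n` in this direction produces tangent vectors at the group-like elements `v_n`, and an
induction on `n` identifies the `n`-th of them with `[n]_q X_n`.

A linear functional takes the value `β + γ` on group-like characters of weight `(β, γ)` and `β - γ`
on the tangent vectors at them. Hence the `v_n` are distinct group-like elements, so independent,
the `X_n` are nonzero, and convolving a linear relation with a functional dual to the `v_n` isolates
a single `X_n` modulo the `v_n`. The `v_n` and `X_n` span because the action of `a + β b` is undone
by that of `a + q⁻¹ γ b` applied afterwards, and the difference of a raising and a lowering step is
a multiple of the action of `b`, from which those of `a`, `c` and `d` follow.
-/

noncomputable section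

open SLq CoisoK

section SkewPrimitive

variable {K C ι κ : Type*} [Field K] [AddCommGroup C] [Module K C]

theorem exists_dual_apply_eq_ite [DecidableEq ι] {g : ι → C} (hg : LinearIndependent K g) (i : ι) :
    ∃ f : Module.Dual K C, ∀ j, f (g j) = if j = i then 1 else 0 := by
  obtain ⟨coords, hcoords⟩ := LinearMap.exists_leftInverse_of_injective
    (Finsupp.linearCombination K g) (LinearMap.ker_eq_bot.2 hg)
  refine ⟨Finsupp.lapply i ∘ₗ coords, fun j => ?_⟩
  have hj : coords (g j) = Finsupp.single j 1 := by
    simpa using LinearMap.congr_fun hcoords (Finsupp.single j 1)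
  simp [hj, Finsupp.single_apply]

variable [Coalgebra K C]

variable (K) in
/-- `x` is skew-primitive over `g`, that is, a tangent vector of the coalgebra at `g` when `g` is
group-like: `g + ε x` is then group-like over the dual numbers. -/
def IsSkewPrimitiveElem (g x : C) : Prop :=
  Coalgebra.comul (R := K) x = x ⊗ₜ g + g ⊗ₜ x

theorem IsSkewPrimitiveElem.smul {g x : C} (hx : IsSkewPrimitiveElem K g x) (z : K) :
    IsSkewPrimitiveElem K g (z • x) := by
  rw [IsSkewPrimitiveElem, map_smul, hx, smul_add, TensorProduct.smul_tmul',
    TensorProduct.tmul_smul]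

/-- The operator `(f ⊗ id) ∘ Δ`, the transpose of the convolution by the functional `f`. -/
def leftConv (f : Module.Dual K C) : C →ₗ[K] C :=
  TensorProduct.lid K C ∘ₗ f.rTensor C ∘ₗ Coalgebra.comul

theorem leftConv_of_isGroupLikeElem {g : C} (hg : IsGroupLikeElem K g) (f : Module.Dual K C) :
    leftConv f g = f g • g := by
  simp [leftConv, hg.comul_eq_tmul_self]

theorem leftConv_of_isSkewPrimitiveElem {g x : C} (hx : IsSkewPrimitiveElem K g x)
    (f : Module.Dual K C) : leftConv f x = f x • g + f g • x := by
  have hx' : Coalgebra.comul (R := K) x = x ⊗ₜ g + g ⊗ₜ x := hx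
  simp [leftConv, hx']

theorem leftConv_of_mem_span [DecidableEq ι] {g : ι → C} (hg : ∀ i, IsGroupLikeElem K (g i))
    {f : Module.Dual K C} {i : ι} (hf : ∀ j, f (g j) = if j = i then 1 else 0) {x : C}
    (hx : x ∈ Submodule.span K (Set.range g)) : leftConv f x = f x • g i := by
  suffices Set.EqOn (leftConv f) (f.smulRight (g i)) (Submodule.span K (Set.range g)) from this hx
  refine LinearMap.eqOn_span ?_
  rintro _ ⟨j, rfl⟩
  rw [leftConv_of_isGroupLikeElem (hg j), LinearMap.smulRight_apply, hf]
  split_ifs with hji <;> simp [hji]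

theorem linearIndependent_of_isGroupLikeElem {g : ι → C} (hg : ∀ i, IsGroupLikeElem K (g i))
    (hg_inj : Function.Injective g) : LinearIndependent K g :=
  linearIndepOn_isGroupLikeElem.linearIndependent.comp (fun i => ⟨g i, hg i⟩)
    fun _ _ h => hg_inj (congrArg Subtype.val h)

theorem IsSkewPrimitiveElem.eq_zero_of_mem_span {g : ι → C} (hg : ∀ i, IsGroupLikeElem K (g i))
    (hg_inj : Function.Injective g) {i : ι} {x : C} (hx : IsSkewPrimitiveElem K (g i) x)
    (hx_mem : x ∈ Submodule.span K (Set.range g)) : x = 0 := by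
  classical
  obtain ⟨f, hf⟩ := exists_dual_apply_eq_ite (linearIndependent_of_isGroupLikeElem hg hg_inj) i
  have h := leftConv_of_isSkewPrimitiveElem hx f
  rw [leftConv_of_mem_span hg hf hx_mem, hf, if_pos rfl, one_smul] at h
  exact left_eq_add.1 h

theorem linearIndependent_mkQ_of_isSkewPrimitiveElem {g : ι → C}
    (hg : ∀ i, IsGroupLikeElem K (g i)) (hg_inj : Function.Injective g) {σ : κ → ι}
    (hσ : Function.Injective σ) {x : κ → C} (hx : ∀ j, IsSkewPrimitiveElem K (g (σ j)) (x j))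
    (hx_ne : ∀ j, x j ≠ 0) :
    LinearIndependent K ((Submodule.span K (Set.range g)).mkQ ∘ x) := by
  classical
  set V := Submodule.span K (Set.range g)
  have hgV : ∀ i, g i ∈ V := fun i => Submodule.subset_span ⟨i, rfl⟩
  rw [linearIndependent_iff']
  intro s z hz j hj
  by_contra hzj
  obtain ⟨f, hf⟩ :=
    exists_dual_apply_eq_ite (linearIndependent_of_isGroupLikeElem hg hg_inj) (σ j)
  have hsum : ∑ k ∈ s, z k • x k ∈ V := by
    rw [← Submodule.Quotient.mk_eq_zero, ← hz, ← Submodule.mkQ_apply, map_sum]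
    simp only [map_smul, Function.comp_apply]
  -- Modulo `V`, the operator `leftConv f` retains only the `j`-th term of the sum.
  have hconv : ∑ k ∈ s, (z k * f (x k)) • g (σ k) + z j • x j ∈ V := by
    have h := V.smul_mem (f (∑ k ∈ s, z k • x k)) (hgV (σ j))
    rw [← leftConv_of_mem_span hg hf hsum, map_sum] at h
    simpa [leftConv_of_isSkewPrimitiveElem (hx _), hf, hσ.eq_iff, smul_add, smul_smul,
      Finset.sum_add_distrib, hj] using h
  rw [V.add_mem_iff_right (V.sum_mem fun k _ => V.smul_mem _ (hgV _)), V.smul_mem_iff hzj] at hconv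
  exact hx_ne j ((hx j).eq_zero_of_mem_span hg hg_inj hconv)

theorem linearIndependent_sumElim_of_isSkewPrimitiveElem {g : ι → C}
    (hg : ∀ i, IsGroupLikeElem K (g i)) (hg_inj : Function.Injective g) {σ : κ → ι}
    (hσ : Function.Injective σ) {x : κ → C} (hx : ∀ j, IsSkewPrimitiveElem K (g (σ j)) (x j))
    (hx_ne : ∀ j, x j ≠ 0) : LinearIndependent K (Sum.elim g x) := by
  have hg_indep := linearIndependent_of_isGroupLikeElem hg hg_inj
  exact LinearIndependent.sumElim_of_quotient (M' := Submodule.span K (Set.range g))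
    (f := fun i => ⟨g i, Submodule.subset_span ⟨i, rfl⟩⟩)
    (hg_indep.of_comp (Submodule.subtype _)) x
    (linearIndependent_mkQ_of_isSkewPrimitiveElem hg hg_inj hσ hx hx_ne)

end SkewPrimitive

namespace Rq

section QNumbers

variable {Q : ℂ}

theorem pow_sub_inv_ne_zero (hQ : ¬IsOfFinOrder Q) (hQ₀ : Q ≠ 0) {n : ℕ} (hn : 0 < n) :
    Q ^ n - (Q ^ n)⁻¹ ≠ 0 := by
  intro h
  refine hQ (isOfFinOrder_iff_pow_eq_one.2 ⟨n + n, by omega, ?_⟩)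
  rw [pow_add]
  nth_rewrite 2 [sub_eq_zero.1 h]
  exact mul_inv_cancel₀ (pow_ne_zero n hQ₀)

theorem sub_inv_ne_zero (hQ : ¬IsOfFinOrder Q) (hQ₀ : Q ≠ 0) : Q - Q⁻¹ ≠ 0 := by
  simpa using pow_sub_inv_ne_zero hQ hQ₀ one_pos

theorem pow_add_inv_injective (hQ : ¬IsOfFinOrder Q) (hQ₀ : Q ≠ 0) :
    Function.Injective fun n : ℕ => Q ^ n + (Q ^ n)⁻¹ := by
  refine Function.Injective.of_lt_imp_ne fun m n hmn h => ?_
  obtain ⟨k, rfl⟩ := Nat.exists_eq_add_of_lt hmn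
  have hfactor : (Q ^ (k + 1) - 1) * (Q ^ (m + m + k + 1) - 1) = 0 := by
    field_simp at h
    refine mul_left_cancel₀ (pow_ne_zero m hQ₀) ?_
    linear_combination -h
  have pow_sub_one_ne_zero (l : ℕ) : Q ^ (l + 1) - 1 ≠ 0 := fun hl =>
    hQ (isOfFinOrder_iff_pow_eq_one.2 ⟨l + 1, l.succ_pos, sub_eq_zero.1 hl⟩)
  exact mul_ne_zero (pow_sub_one_ne_zero k) (pow_sub_one_ne_zero (m + m + k)) hfactor

theorem qNum_zero (Q : ℂ) : qNum Q 0 = 0 := by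
  simp [qNum]

theorem qNum_one (hQ : ¬IsOfFinOrder Q) (hQ₀ : Q ≠ 0) : qNum Q 1 = 1 := by
  rw [qNum, pow_one, div_self (sub_inv_ne_zero hQ hQ₀)]

theorem sub_inv_mul_qNum (hQ : ¬IsOfFinOrder Q) (hQ₀ : Q ≠ 0) (n : ℕ) :
    (Q - Q⁻¹) * qNum Q n = Q ^ n - (Q ^ n)⁻¹ :=
  mul_div_cancel₀ _ (sub_inv_ne_zero hQ hQ₀)

theorem qNum_ne_zero (hQ : ¬IsOfFinOrder Q) (hQ₀ : Q ≠ 0) {n : ℕ} (hn : 0 < n) : qNum Q n ≠ 0 :=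
  div_ne_zero (pow_sub_inv_ne_zero hQ hQ₀ hn) (sub_inv_ne_zero hQ hQ₀)

theorem qNum_add (hQ₀ : Q ≠ 0) (m n : ℕ) :
    qNum Q (m + n) = (Q ^ n)⁻¹ * qNum Q m + Q ^ m * qNum Q n := by
  rw [qNum, qNum, qNum, ← mul_div_assoc, ← mul_div_assoc, ← add_div]
  congr 1
  field_simp
  ring

theorem qFact_succ (Q : ℂ) (n : ℕ) : qFact Q (n + 1) = qFact Q n * qNum Q (n + 1) :=
  Finset.prod_Icc_succ_top n.succ_pos _

theorem qFact_ne_zero (hQ : ¬IsOfFinOrder Q) (hQ₀ : Q ≠ 0) (n : ℕ) : qFact Q n ≠ 0 :=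
  Finset.prod_ne_zero_iff.2 fun _ hi => qNum_ne_zero hQ hQ₀ (Finset.mem_Icc.1 hi).1

theorem conj_qNum (q : Circle) (n : ℕ) : starRingEnd ℂ (qNum q n) = qNum q n := by
  have hq : starRingEnd ℂ (q : ℂ) = (q : ℂ)⁻¹ := by
    rw [← Circle.coe_inv_eq_conj, Circle.coe_inv]
  simp only [qNum, map_div₀, map_sub, map_inv₀, map_pow, hq, inv_pow, inv_inv]
  rw [← neg_sub, ← neg_sub (q : ℂ), neg_div_neg_eq]

end QNumbers

end Rq

namespace SLq

section TriangularRep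

variable (q : Circle) (x y : ℂ)

/-- The two-dimensional representation of `SL_q(2, ℝ)` by upper triangular matrices in which `b` and
`c` act by the nilpotent matrices with entries `x` and `y`. -/
def triangularRep : SLq q →ₐ[ℂ] Matrix (Fin 2) (Fin 2) ℂ :=
  lift q !![1, 0; 0, (q : ℂ)⁻¹] !![0, x; 0, 0] !![0, y; 0, 0] !![1, 0; 0, (q : ℂ)] <| by
    constructor <;> ext i j <;> fin_cases i <;> fin_cases j <;> simp <;> field_simp

theorem triangularRep_apply_one_zero (z : SLq q) : triangularRep q x y z 1 0 = 0 := by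
  induction z using SLq.induction with
  | hz r => simp [Matrix.algebraMap_matrix_apply]
  | hadd z w hz hw => simp [hz, hw]
  | hmul z w hz hw => simp [Matrix.mul_apply, hz, hw]
  | _ => simp [triangularRep]

theorem triangularRep_apply_zero_zero (z : SLq q) :
    triangularRep q x y z 0 0 = Coalgebra.counit (R := ℂ) z := by
  induction z using SLq.induction with
  | hz r => simp [Matrix.algebraMap_matrix_apply]
  | hadd z w hz hw => simp [hz, hw]
  | hmul z w hz hw => simp [Matrix.mul_apply, hz, hw, triangularRep_apply_one_zero]
  | _ => simp [triangularRep, counit_def, counitHom]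

end TriangularRep

end SLq

local notation:75 m:75 "◁" x:76 => CoisoK.act _ _ _ x m

namespace CoisoK

variable {p : Circle} {μ ν : ℝ}

local notation "q" => (p : ℂ) ^ 2

section Action

variable (m : CoisoK p μ ν) (x y : SLq (p ^ 2))

theorem proj_surjective : Function.Surjective (proj p μ ν) :=
  (rightIdeal p μ ν).mkQ_surjective

theorem act_act : m ◁ x ◁ y = m ◁ (x * y) := by
  obtain ⟨z, rfl⟩ := proj_surjective m
  simp only [act_proj, mul_assoc]

theorem act_add : m ◁ (x + y) = m ◁ x + m ◁ y := by
  obtain ⟨z, rfl⟩ := proj_surjective m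
  simp only [act_proj, mul_add, map_add]

theorem act_smul (r : ℂ) : m ◁ (r • x) = r • m ◁ x := by
  obtain ⟨z, rfl⟩ := proj_surjective m
  simp only [act_proj, mul_smul_comm, map_smul]

theorem act_one : m ◁ 1 = m := by
  obtain ⟨z, rfl⟩ := proj_surjective m
  rw [act_proj, mul_one]

theorem act_b_act_a : m ◁ b _ ◁ a _ = q⁻¹ • m ◁ a _ ◁ b _ := by
  simp only [act_act, b_mul_a, act_smul, Circle.coe_pow]

theorem act_b_pow_act_a (i : ℕ) :
    m ◁ b _ ^ i ◁ a _ = (q ^ i)⁻¹ • m ◁ a _ ◁ b _ ^ i := by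
  induction i with
  | zero => simp only [pow_zero, act_one, inv_one, one_smul]
  | succ i ih =>
    rw [pow_succ (b _), ← act_act, act_b_act_a, ih, map_smul, smul_smul, act_act _ (b _ ^ i),
      pow_succ q, mul_inv_rev]

theorem act_a_act_c : m ◁ a _ ◁ c _ = q • m ◁ c _ ◁ a _ := by
  simp only [act_act, a_mul_c, act_smul, Circle.coe_pow]

theorem act_b_act_c : m ◁ b _ ◁ c _ = m ◁ c _ ◁ b _ := by
  simp only [act_act, b_mul_c]

theorem act_b_act_d : m ◁ b _ ◁ d _ = q • m ◁ d _ ◁ b _ := by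
  simp only [act_act, b_mul_d, act_smul, Circle.coe_pow]

theorem act_d_act_a : m ◁ d _ ◁ a _ = m + q⁻¹ • m ◁ c _ ◁ b _ := by
  simp only [act_act, d_mul_a, act_add, act_one, act_smul, b_mul_c, Circle.coe_pow]

theorem act_a_act_d : m ◁ a _ ◁ d _ = m + q • m ◁ c _ ◁ b _ := by
  simp only [act_act, a_mul_d, act_add, act_one, act_smul, b_mul_c, Circle.coe_pow]

theorem tau_act : tau p μ ν (m ◁ x) = tau p μ ν m ◁ SLq.tau _ x := by
  obtain ⟨z, rfl⟩ := proj_surjective m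
  rw [act_proj, tau_proj, tau_proj, act_proj, tau_mul]

theorem counit_act : Coalgebra.counit (R := ℂ) (m ◁ x) =
    Coalgebra.counit (R := ℂ) m * Coalgebra.counit (R := ℂ) x := by
  obtain ⟨z, rfl⟩ := proj_surjective m
  simp only [act_proj, counit_proj, Bialgebra.counit_mul]

theorem comul_act {x y z y' z' : SLq (p ^ 2)}
    (hx : Coalgebra.comul (R := ℂ) x = y ⊗ₜ z + y' ⊗ₜ z') (m : CoisoK p μ ν) :
    Coalgebra.comul (R := ℂ) (m ◁ x) =
      TensorProduct.map (act p μ ν y) (act p μ ν z) (Coalgebra.comul m) +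
        TensorProduct.map (act p μ ν y') (act p μ ν z') (Coalgebra.comul m) := by
  obtain ⟨u, rfl⟩ := proj_surjective m
  rw [act_proj, comul_proj, comul_proj, Bialgebra.comul_mul, hx]
  induction Coalgebra.comul (R := ℂ) u with
  | zero => simp
  | tmul s t => simp [mul_add, act_proj]
  | add s t hs ht =>
    rw [add_mul, map_add, hs, ht]
    simp only [map_add]
    abel

theorem comul_act_a : Coalgebra.comul (R := ℂ) (m ◁ a _) =
    TensorProduct.map (act p μ ν (a _)) (act p μ ν (a _)) (Coalgebra.comul m) +
      TensorProduct.map (act p μ ν (b _)) (act p μ ν (c _)) (Coalgebra.comul m) :=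
  comul_act (by rw [comul_def, comulHom, lift_a]) m

theorem comul_act_b : Coalgebra.comul (R := ℂ) (m ◁ b _) =
    TensorProduct.map (act p μ ν (a _)) (act p μ ν (b _)) (Coalgebra.comul m) +
      TensorProduct.map (act p μ ν (b _)) (act p μ ν (d _)) (Coalgebra.comul m) :=
  comul_act (by rw [comul_def, comulHom, lift_b]) m

end Action

theorem le_comap_act_of_generators {W : Submodule ℂ (CoisoK p μ ν)}
    (ha : W ≤ W.comap (act p μ ν (a _))) (hb : W ≤ W.comap (act p μ ν (b _)))
    (hc : W ≤ W.comap (act p μ ν (c _))) (hd : W ≤ W.comap (act p μ ν (d _)))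
    (x : SLq (p ^ 2)) : W ≤ W.comap (act p μ ν x) := by
  induction x using SLq.induction with
  | hz z =>
    intro m hm
    rw [Submodule.mem_comap, Algebra.algebraMap_eq_smul_one, act_smul, act_one]
    exact W.smul_mem z hm
  | ha => exact ha
  | hb => exact hb
  | hc => exact hc
  | hd => exact hd
  | hadd x y hx hy =>
    intro m hm
    rw [Submodule.mem_comap, act_add]
    exact W.add_mem (hx hm) (hy hm)
  | hmul x y hx hy =>
    intro m hm
    rw [Submodule.mem_comap, ← act_act]
    exact hy (hx hm)

theorem eq_top_of_le_comap_act {W : Submodule ℂ (CoisoK p μ ν)} (h_one : proj p μ ν 1 ∈ W)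
    (ha : W ≤ W.comap (act p μ ν (a _))) (hb : W ≤ W.comap (act p μ ν (b _)))
    (hc : W ≤ W.comap (act p μ ν (c _))) (hd : W ≤ W.comap (act p μ ν (d _))) : W = ⊤ := by
  refine eq_top_iff.2 fun m _ => ?_
  obtain ⟨x, rfl⟩ := proj_surjective m
  have hx := le_comap_act_of_generators ha hb hc hd x h_one
  rwa [Submodule.mem_comap, act_proj, one_mul] at hx

/-- The action of `a + β b`. -/
def shift (β : ℂ) : CoisoK p μ ν →ₗ[ℂ] CoisoK p μ ν :=
  act p μ ν (a _ + β • b _)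

theorem shift_apply (β : ℂ) (m : CoisoK p μ ν) : shift β m = m ◁ a _ + β • m ◁ b _ := by
  rw [shift, act_add, act_smul]

theorem shift_sub_shift (β γ : ℂ) (m : CoisoK p μ ν) :
    shift β m - shift γ m = (β - γ) • m ◁ b _ := by
  simp only [shift_apply]
  module

theorem act_a_eq (β : ℂ) (m : CoisoK p μ ν) : m ◁ a _ = shift β m - β • m ◁ b _ := by
  rw [shift_apply, add_sub_cancel_right]

/-- `x` is a character of weight `(β, γ)`: the elements `c + β γ b` and `d - a - (β + γ) b` of the
algebra act on `x` as zero. -/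
structure IsCharacter (β γ : ℂ) (x : CoisoK p μ ν) : Prop where
  act_c : x ◁ c _ = -(β * γ) • x ◁ b _
  act_d : x ◁ d _ = x ◁ a _ + (β + γ) • x ◁ b _

/-- `t` is tangent at `x` to the family of characters of weight `(β, γ)`: if `x` is a character of
weight `(β, γ)` and `ε ^ 2 = 0`, then `x + ε t` is a character of weight
`(β (1 + ε), γ (1 - ε))`. -/
structure IsTangent (β γ : ℂ) (x t : CoisoK p μ ν) : Prop where
  act_c : t ◁ c _ = -(β * γ) • t ◁ b _
  act_d : t ◁ d _ = t ◁ a _ + (β + γ) • t ◁ b _ + (β - γ) • x ◁ b _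

theorem isCharacter_zero (β γ : ℂ) : IsCharacter β γ (0 : CoisoK p μ ν) := by
  constructor <;> simp only [map_zero, smul_zero, add_zero]

theorem isTangent_zero_left {β γ : ℂ} {x : CoisoK p μ ν} :
    IsTangent β γ 0 x ↔ IsCharacter β γ x :=
  ⟨fun h => ⟨h.act_c, by simpa using h.act_d⟩, fun h => ⟨h.act_c, by simpa using h.act_d⟩⟩

theorem isCharacter_proj_one {β γ : ℂ} (hadd : β + γ = 2 * p * μ) (hmul : β * γ = q * ν) :
    IsCharacter β γ (proj p μ ν 1) := by
  have proj_eq_zero {x : SLq (p ^ 2)} (hx : x ∈ coideal p μ ν) : proj p μ ν x = 0 :=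
    (Submodule.Quotient.mk_eq_zero _).2
      (mul_one x ▸ Submodule.mul_mem_mul hx Submodule.mem_top)
  have hX := proj_eq_zero (genX_mem p μ ν)
  have hY := proj_eq_zero (genY_mem p μ ν)
  simp only [genX, genY, map_add, map_sub, map_smul] at hX hY
  constructor
  · rw [act_proj, act_proj, one_mul, one_mul, hmul, neg_smul, eq_neg_iff_add_eq_zero, add_comm, hY]
  · simp only [act_proj, one_mul, hadd]
    rw [← sub_eq_zero, ← neg_eq_zero, ← hX]
    module

namespace IsTangent

variable {β γ : ℂ} {x t : CoisoK p μ ν}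

theorem eq_quadratic (ht : IsTangent β γ x t) :
    t = t ◁ a _ ◁ a _ + (q⁻¹ * (β + γ)) • t ◁ a _ ◁ b _ + (q⁻¹ * (β * γ)) • t ◁ b _ ◁ b _ +
      (q⁻¹ * (β - γ)) • x ◁ a _ ◁ b _ := by
  have h := act_d_act_a t
  simp only [ht.act_d, ht.act_c, map_add, map_smul, act_b_act_a] at h
  refine (eq_sub_of_add_eq h.symm).trans ?_
  module

theorem shift (hx : IsCharacter β γ x) (ht : IsTangent β γ x t) :
    IsTangent (q * β) (q⁻¹ * γ) (CoisoK.shift β x) (CoisoK.shift β t + β • x ◁ b _) := by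
  constructor
  · simp only [shift_apply, map_add, map_smul, act_a_act_c, act_b_act_c, ht.act_c, hx.act_c,
      act_b_act_a]
    match_scalars <;> field_simp
  · simp only [shift_apply, map_add, map_smul, act_a_act_d, act_b_act_d, ht.act_c, ht.act_d,
      hx.act_d, act_b_act_a]
    nth_rewrite 1 [ht.eq_quadratic]
    match_scalars <;> field_simp <;> ring

theorem shift_shift (ht : IsTangent β γ x t) :
    CoisoK.shift (q⁻¹ * γ) (CoisoK.shift β t + β • x ◁ b _) =
      t + (q⁻¹ * γ) • CoisoK.shift β x ◁ b _ := by
  nth_rewrite 2 [ht.eq_quadratic]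
  simp only [shift_apply, map_add, map_smul, act_b_act_a]
  match_scalars <;> field_simp <;> ring

theorem isSkewPrimitiveElem_shift (hx : IsCharacter β γ x) (hx_comul : IsGroupLikeElem ℂ x)
    (ht : IsTangent β γ x t) (ht_comul : IsSkewPrimitiveElem ℂ x t) :
    IsSkewPrimitiveElem ℂ (CoisoK.shift β x) (CoisoK.shift β t + β • x ◁ b _) := by
  rw [IsSkewPrimitiveElem] at ht_comul ⊢
  simp only [shift_apply, map_add, map_smul, comul_act_a, comul_act_b, hx_comul.comul_eq_tmul_self,
    ht_comul, TensorProduct.map_tmul, hx.act_c, hx.act_d, ht.act_c, ht.act_d,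
    TensorProduct.add_tmul, TensorProduct.tmul_add, ← TensorProduct.smul_tmul',
    TensorProduct.tmul_smul]
  module

theorem tau_shift (hβ : starRingEnd ℂ β = q⁻¹ * γ) (ht : IsTangent β γ x t)
    (hx_tau : tau p μ ν x = x) (ht_tau : tau p μ ν t = -t) :
    tau p μ ν (CoisoK.shift β t + β • x ◁ b _) = -(CoisoK.shift β t + β • x ◁ b _) := by
  simp only [shift_apply, map_add, LinearMap.map_smulₛₗ, tau_act, hβ, tau_a, tau_b, hx_tau, ht_tau,
    ← neg_smul, act_smul, map_neg, ht.act_d, Circle.coe_pow]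
  match_scalars <;> field_simp <;> ring

end IsTangent

namespace IsCharacter

variable {β γ : ℂ} {x : CoisoK p μ ν}

theorem shift (hx : IsCharacter β γ x) : IsCharacter (q * β) (q⁻¹ * γ) (CoisoK.shift β x) := by
  simpa [isTangent_zero_left] using
    IsTangent.shift (isCharacter_zero β γ) (isTangent_zero_left.2 hx)

theorem shift_shift (hx : IsCharacter β γ x) :
    CoisoK.shift (q⁻¹ * γ) (CoisoK.shift β x) = x := by
  simpa using IsTangent.shift_shift (isTangent_zero_left.2 hx)

theorem isGroupLikeElem_shift (hx : IsCharacter β γ x) (hx_comul : IsGroupLikeElem ℂ x) :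
    IsGroupLikeElem ℂ (CoisoK.shift β x) where
  counit_eq_one := by
    simp [shift_apply, counit_act, hx_comul.counit_eq_one, counit_def, counitHom]
  comul_eq_tmul_self := by
    simp only [shift_apply, map_add, map_smul, comul_act_a, comul_act_b,
      hx_comul.comul_eq_tmul_self, TensorProduct.map_tmul, hx.act_c, hx.act_d,
      TensorProduct.add_tmul, TensorProduct.tmul_add, ← TensorProduct.smul_tmul',
      TensorProduct.tmul_smul]
    module

theorem tau_shift (hβ : starRingEnd ℂ β = q⁻¹ * γ) (hx : IsCharacter β γ x)
    (hx_tau : tau p μ ν x = x) : tau p μ ν (CoisoK.shift β x) = CoisoK.shift β x := by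
  simp only [shift_apply, map_add, LinearMap.map_smulₛₗ, tau_act, hβ, tau_a, tau_b, hx_tau,
    ← neg_smul, act_smul, hx.act_d, Circle.coe_pow]
  match_scalars <;> field_simp
  ring

end IsCharacter

section WeightSum

variable (p μ ν)

/-- The representation of `SL_q(2, ℝ)` in which the row vector `(1, 2 q^(1/2) μ)` spans the quotient
`K_{μν}`. -/
abbrev weightRep : SLq (p ^ 2) →ₐ[ℂ] Matrix (Fin 2) (Fin 2) ℂ :=
  triangularRep (p ^ 2) (q - q⁻¹) (-(q * ν * (q - q⁻¹)))

/-- The linear functional on `SL_q(2, ℝ)` which induces `CoisoK.weightSum`. -/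
def weightSumLift : SLq (p ^ 2) →ₗ[ℂ] ℂ where
  toFun z := weightRep p ν z 0 1 + 2 * p * μ * weightRep p ν z 1 1
  map_add' z w := by simp only [map_add, Matrix.add_apply]; ring
  map_smul' r z := by simp only [map_smul, Matrix.smul_apply, smul_eq_mul, RingHom.id_apply]; ring

theorem weightSumLift_a : weightSumLift p μ ν (a _) = 2 * p * μ * q⁻¹ := by
  simp [weightSumLift, triangularRep]

theorem weightSumLift_b : weightSumLift p μ ν (b _) = q - q⁻¹ := by
  simp [weightSumLift, triangularRep]

theorem weightSumLift_c : weightSumLift p μ ν (c _) = -(q * ν * (q - q⁻¹)) := by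
  simp [weightSumLift, triangularRep]

theorem weightSumLift_d : weightSumLift p μ ν (d _) = 2 * p * μ * q := by
  simp [weightSumLift, triangularRep]

theorem weightSumLift_mul (z w : SLq (p ^ 2)) : weightSumLift p μ ν (z * w) =
    weightRep p ν w 0 1 * Coalgebra.counit z + weightRep p ν w 1 1 * weightSumLift p μ ν z := by
  simp only [weightSumLift, LinearMap.coe_mk, AddHom.coe_mk, map_mul, Matrix.mul_apply,
    Fin.sum_univ_two, triangularRep_apply_one_zero, triangularRep_apply_zero_zero]
  ring

theorem rightIdeal_le_ker_weightSumLift :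
    rightIdeal p μ ν ≤ LinearMap.ker (weightSumLift p μ ν) := by
  refine Submodule.mul_le.2 fun x hx w _ => ?_
  have hx_counit : Coalgebra.counit (R := ℂ) x = 0 :=
    Submodule.IsCoideal.counit_eq_zero (I := rightIdeal p μ ν)
      (mul_one x ▸ Submodule.mul_mem_mul hx Submodule.mem_top)
  suffices coideal p μ ν ≤ LinearMap.ker (weightSumLift p μ ν) by
    rw [LinearMap.mem_ker, weightSumLift_mul, hx_counit, LinearMap.mem_ker.1 (this hx)]
    ring
  refine Submodule.span_le.2 ?_
  rintro _ (rfl | rfl)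
  · rw [SetLike.mem_coe, LinearMap.mem_ker, genX, map_add, map_sub, map_smul, weightSumLift_a,
      weightSumLift_b, weightSumLift_d, smul_eq_mul]
    ring
  · rw [SetLike.mem_coe, LinearMap.mem_ker, genY, map_add, map_smul, weightSumLift_b,
      weightSumLift_c, smul_eq_mul]
    ring

/-- The linear functional on `K_{μν}` whose value on a group-like character of weight `(β, γ)` is
`β + γ`. -/
def weightSum : CoisoK p μ ν →ₗ[ℂ] ℂ :=
  (rightIdeal p μ ν).liftQ (weightSumLift p μ ν) (rightIdeal_le_ker_weightSumLift p μ ν)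

variable {p μ ν}

theorem weightSum_act (m : CoisoK p μ ν) (x : SLq (p ^ 2)) : weightSum p μ ν (m ◁ x) =
    weightRep p ν x 0 1 * Coalgebra.counit m + weightRep p ν x 1 1 * weightSum p μ ν m := by
  obtain ⟨z, rfl⟩ := proj_surjective m
  exact weightSumLift_mul p μ ν z x

theorem weightSum_act_a (m : CoisoK p μ ν) :
    weightSum p μ ν (m ◁ a _) = q⁻¹ * weightSum p μ ν m := by
  simp [weightSum_act, triangularRep]

theorem weightSum_act_b (m : CoisoK p μ ν) :
    weightSum p μ ν (m ◁ b _) = (q - q⁻¹) * Coalgebra.counit m := by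
  simp [weightSum_act, triangularRep]

theorem weightSum_act_d (m : CoisoK p μ ν) :
    weightSum p μ ν (m ◁ d _) = q * weightSum p μ ν m := by
  simp [weightSum_act, triangularRep]

theorem IsTangent.weightSum_eq (hq : ¬IsOfFinOrder q) {β γ : ℂ} {x t : CoisoK p μ ν}
    (ht : IsTangent β γ x t) : weightSum p μ ν t =
      (β + γ) * Coalgebra.counit t + (β - γ) * Coalgebra.counit x := by
  have h := congrArg (weightSum p μ ν) ht.act_d
  simp only [map_add, map_smul, weightSum_act_a, weightSum_act_b, weightSum_act_d, smul_eq_mul] at h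
  refine mul_left_cancel₀ (Rq.sub_inv_ne_zero hq (pow_ne_zero 2 p.coe_ne_zero)) ?_
  linear_combination h

theorem IsCharacter.weightSum_eq (hq : ¬IsOfFinOrder q) {β γ : ℂ} {x : CoisoK p μ ν}
    (hx : IsCharacter β γ x) : weightSum p μ ν x = (β + γ) * Coalgebra.counit x := by
  simpa using (isTangent_zero_left.2 hx).weightSum_eq hq

end WeightSum

end CoisoK

namespace Rq

variable {p : Circle} {μ : ℝ}

open Finset.HasAntidiagonal (antidiagonal mem_antidiagonal)

local notation "q" => (p : ℂ) ^ 2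

section Weights

variable (p μ)

/-- The weight `β = q^(n + 1/2) μ` of `v_n`. -/
def upWeight (n : ℕ) : ℂ :=
  q ^ n * (p * μ)

/-- The weight `γ = q^(-n + 1/2) μ` of `v_n`. -/
def downWeight (n : ℕ) : ℂ :=
  (q ^ n)⁻¹ * (p * μ)

theorem upWeight_succ (n : ℕ) : upWeight p μ (n + 1) = q * upWeight p μ n := by
  rw [upWeight, upWeight, pow_succ', mul_assoc]

theorem downWeight_succ (n : ℕ) : downWeight p μ (n + 1) = q⁻¹ * downWeight p μ n := by
  rw [downWeight, downWeight, pow_succ', mul_inv, mul_assoc]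

theorem conj_upWeight (n : ℕ) :
    starRingEnd ℂ (upWeight p μ n) = q⁻¹ * downWeight p μ n := by
  have hp : starRingEnd ℂ (p : ℂ) = (p : ℂ)⁻¹ := by
    rw [← Circle.coe_inv_eq_conj, Circle.coe_inv]
  simp only [upWeight, downWeight, map_mul, map_pow, hp, inv_pow, Complex.conj_ofReal]
  field_simp

variable {μ}

theorem mul_ofReal_ne_zero (hμ : μ ≠ 0) : (p * μ : ℂ) ≠ 0 :=
  mul_ne_zero p.coe_ne_zero (Complex.ofReal_ne_zero.2 hμ)

theorem upWeight_ne_zero (hμ : μ ≠ 0) (n : ℕ) : upWeight p μ n ≠ 0 :=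
  mul_ne_zero (pow_ne_zero n (pow_ne_zero 2 p.coe_ne_zero)) (mul_ofReal_ne_zero p hμ)

variable {p}

theorem upWeight_sub_downWeight_ne_zero (hq : ¬IsOfFinOrder q) (hμ : μ ≠ 0) {n : ℕ}
    (hn : 0 < n) : upWeight p μ n - downWeight p μ n ≠ 0 := by
  rw [upWeight, downWeight, ← sub_mul]
  exact mul_ne_zero (pow_sub_inv_ne_zero hq (pow_ne_zero 2 p.coe_ne_zero) hn)
    (mul_ofReal_ne_zero p hμ)

theorem upWeight_add_downWeight_injective (hq : ¬IsOfFinOrder q) (hμ : μ ≠ 0) :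
    Function.Injective fun n => upWeight p μ n + downWeight p μ n := by
  intro m n hmn
  refine pow_add_inv_injective hq (pow_ne_zero 2 p.coe_ne_zero) ?_
  simpa only [upWeight, downWeight, ← add_mul, mul_left_inj' (mul_ofReal_ne_zero p hμ)] using hmn

end Weights

variable (p μ) in
/-- The derivative of `v_n` along the weight: it obeys the recursion obtained from
`v_{n+1} = v_n · (a + β b)` by differentiating along `β ∂/∂β`. -/
def dv : ℕ → Rq p μ
  | 0 => 0
  | n + 1 => shift (upWeight p μ n) (dv n) + upWeight p μ n • v p μ n ◁ b _

theorem v_succ (n : ℕ) : v p μ (n + 1) = shift (upWeight p μ n) (v p μ n) := by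
  have hβ : (p : ℂ) ^ (2 * n + 1) * μ = upWeight p μ n := by
    rw [upWeight]
    ring
  rw [v, w, v, shift, act_proj, hβ]

theorem isCharacter_v (n : ℕ) :
    IsCharacter (upWeight p μ n) (downWeight p μ n) (v p μ n) := by
  induction n with
  | zero =>
    apply isCharacter_proj_one <;> simp only [upWeight, downWeight, pow_zero, inv_one, one_mul]
    · ring
    · push_cast
      ring
  | succ n ih =>
    rw [v_succ, upWeight_succ, downWeight_succ]
    exact ih.shift

theorem isTangent_dv (n : ℕ) :
    IsTangent (upWeight p μ n) (downWeight p μ n) (v p μ n) (dv p μ n) := by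
  induction n with
  | zero => constructor <;> simp [dv, upWeight, downWeight]
  | succ n ih =>
    rw [v_succ, dv, upWeight_succ, downWeight_succ]
    exact ih.shift (isCharacter_v n)

theorem isGroupLikeElem_v (n : ℕ) : IsGroupLikeElem ℂ (v p μ n) := by
  induction n with
  | zero =>
    constructor <;> simp [v, w, counit_proj, comul_proj, Algebra.TensorProduct.one_def]
  | succ n ih =>
    rw [v_succ]
    exact (isCharacter_v n).isGroupLikeElem_shift ih

theorem isSkewPrimitiveElem_dv (n : ℕ) : IsSkewPrimitiveElem ℂ (v p μ n) (dv p μ n) := by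
  induction n with
  | zero => simp [IsSkewPrimitiveElem, dv]
  | succ n ih =>
    rw [v_succ, dv]
    exact (isTangent_dv n).isSkewPrimitiveElem_shift (isCharacter_v n) (isGroupLikeElem_v n) ih

theorem tau_v (n : ℕ) : tau p μ (μ ^ 2) (v p μ n) = v p μ n := by
  induction n with
  | zero => simp [v, w, tau_proj, SLq.tau_apply, antipodeLin_apply]
  | succ n ih =>
    rw [v_succ]
    exact (isCharacter_v n).tau_shift (conj_upWeight p μ n) ih

theorem tau_dv (n : ℕ) : tau p μ (μ ^ 2) (dv p μ n) = -dv p μ n := by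
  induction n with
  | zero => rw [dv, map_zero, neg_zero]
  | succ n ih =>
    rw [dv]
    exact (isTangent_dv n).tau_shift (conj_upWeight p μ n) (tau_v n) ih

theorem v_injective (hq : ¬IsOfFinOrder q) (hμ : μ ≠ 0) : Function.Injective (v p μ) := by
  intro m n hmn
  have h := congrArg (weightSum p μ (μ ^ 2)) hmn
  simp only [(isCharacter_v _).weightSum_eq hq, (isGroupLikeElem_v _).counit_eq_one, mul_one] at h
  exact upWeight_add_downWeight_injective hq hμ h

theorem dv_ne_zero (hq : ¬IsOfFinOrder q) (hμ : μ ≠ 0) {n : ℕ} (hn : 0 < n) : dv p μ n ≠ 0 := by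
  intro h
  have hsum := (isTangent_dv (p := p) (μ := μ) n).weightSum_eq hq
  rw [h, map_zero, map_zero, mul_zero, zero_add, (isGroupLikeElem_v n).counit_eq_one,
    mul_one] at hsum
  exact upWeight_sub_downWeight_ne_zero hq hμ hn hsum.symm

section Span

variable (p μ) in
/-- The span of the `v_n` and of their derivatives, which turns out to be all of `R_q`. -/
def tangentSpan : Submodule ℂ (Rq p μ) :=
  Submodule.span ℂ (Set.range (v p μ) ∪ Set.range (dv p μ))

theorem v_mem_tangentSpan (n : ℕ) : v p μ n ∈ tangentSpan p μ :=
  Submodule.subset_span (Or.inl ⟨n, rfl⟩)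

theorem dv_mem_tangentSpan (n : ℕ) : dv p μ n ∈ tangentSpan p μ :=
  Submodule.subset_span (Or.inr ⟨n, rfl⟩)

theorem shift_downWeight_v (n : ℕ) :
    shift (downWeight p μ (n + 1)) (v p μ (n + 1)) = v p μ n := by
  rw [v_succ, downWeight_succ, (isCharacter_v n).shift_shift]

theorem shift_downWeight_dv (n : ℕ) : shift (downWeight p μ (n + 1)) (dv p μ (n + 1)) =
    dv p μ n + downWeight p μ (n + 1) • v p μ (n + 1) ◁ b _ := by
  rw [v_succ, dv, downWeight_succ, (isTangent_dv n).shift_shift]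

theorem act_b_v_mem_tangentSpan (hq : ¬IsOfFinOrder q) (hμ : μ ≠ 0) (n : ℕ) :
    v p μ n ◁ b _ ∈ tangentSpan p μ := by
  cases n with
  | zero =>
    have h_dv_one : dv p μ 1 = upWeight p μ 0 • v p μ 0 ◁ b _ := by
      rw [dv, dv, map_zero, zero_add]
    rw [← Submodule.smul_mem_iff _ (upWeight_ne_zero p hμ 0), ← h_dv_one]
    exact dv_mem_tangentSpan 1
  | succ n =>
    rw [← Submodule.smul_mem_iff _ (upWeight_sub_downWeight_ne_zero hq hμ n.succ_pos),
      ← shift_sub_shift, ← v_succ, shift_downWeight_v]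
    exact sub_mem (v_mem_tangentSpan _) (v_mem_tangentSpan _)

theorem shift_dv_mem_tangentSpan (hq : ¬IsOfFinOrder q) (hμ : μ ≠ 0) (n : ℕ) :
    shift (upWeight p μ n) (dv p μ n) ∈ tangentSpan p μ := by
  have h := dv_mem_tangentSpan (p := p) (μ := μ) (n + 1)
  rwa [dv, Submodule.add_mem_iff_left _ (Submodule.smul_mem _ _ (act_b_v_mem_tangentSpan hq hμ n))]
    at h

theorem act_b_dv_mem_tangentSpan (hq : ¬IsOfFinOrder q) (hμ : μ ≠ 0) (n : ℕ) :
    dv p μ n ◁ b _ ∈ tangentSpan p μ := by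
  cases n with
  | zero =>
    rw [dv, map_zero]
    exact zero_mem _
  | succ n =>
    rw [← Submodule.smul_mem_iff _ (upWeight_sub_downWeight_ne_zero hq hμ n.succ_pos),
      ← shift_sub_shift, shift_downWeight_dv]
    exact sub_mem (shift_dv_mem_tangentSpan hq hμ _)
      (add_mem (dv_mem_tangentSpan _) (Submodule.smul_mem _ _ (act_b_v_mem_tangentSpan hq hμ _)))

theorem tangentSpan_le_comap_act {x : SLq (p ^ 2)}
    (hv : ∀ n, act p μ (μ ^ 2) x (v p μ n) ∈ tangentSpan p μ)
    (hdv : ∀ n, act p μ (μ ^ 2) x (dv p μ n) ∈ tangentSpan p μ) :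
    tangentSpan p μ ≤ (tangentSpan p μ).comap (act p μ (μ ^ 2) x) := by
  refine Submodule.span_le.2 ?_
  rintro _ (⟨n, rfl⟩ | ⟨n, rfl⟩)
  exacts [hv n, hdv n]

theorem tangentSpan_eq_top (hq : ¬IsOfFinOrder q) (hμ : μ ≠ 0) : tangentSpan p μ = ⊤ := by
  have hb_v := act_b_v_mem_tangentSpan hq hμ
  have hb_dv := act_b_dv_mem_tangentSpan hq hμ
  have ha_v (n : ℕ) : v p μ n ◁ a _ ∈ tangentSpan p μ := by
    rw [act_a_eq (upWeight p μ n), ← v_succ]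
    exact sub_mem (v_mem_tangentSpan _) (Submodule.smul_mem _ _ (hb_v n))
  have ha_dv (n : ℕ) : dv p μ n ◁ a _ ∈ tangentSpan p μ := by
    rw [act_a_eq (upWeight p μ n)]
    exact sub_mem (shift_dv_mem_tangentSpan hq hμ n) (Submodule.smul_mem _ _ (hb_dv n))
  refine eq_top_of_le_comap_act (v_mem_tangentSpan 0) (tangentSpan_le_comap_act ha_v ha_dv)
    (tangentSpan_le_comap_act hb_v hb_dv) (tangentSpan_le_comap_act (fun n => ?_) fun n => ?_)
    (tangentSpan_le_comap_act (fun n => ?_) fun n => ?_)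
  · rw [(isCharacter_v n).act_c]
    exact Submodule.smul_mem _ _ (hb_v n)
  · rw [(isTangent_dv n).act_c]
    exact Submodule.smul_mem _ _ (hb_dv n)
  · rw [(isCharacter_v n).act_d]
    exact add_mem (ha_v n) (Submodule.smul_mem _ _ (hb_v n))
  · rw [(isTangent_dv n).act_d]
    exact add_mem (add_mem (ha_dv n) (Submodule.smul_mem _ _ (hb_dv n)))
      (Submodule.smul_mem _ _ (hb_v n))

end Span

section Expansion

variable (p μ)

/-- The coefficient of `v_m · b^(j+1)` in `[j+1]_q X_{m+j+1}`. -/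
def coeffX (j m : ℕ) : ℂ :=
  (q - q⁻¹) ^ j * (p * μ) ^ (j + 1) * qFact q (m + j) / qFact q m

theorem X_succ_eq_sum_antidiagonal (n : ℕ) : X p μ (n + 1) =
    ∑ ij ∈ antidiagonal n,
      (coeffX p μ ij.1 ij.2 / qNum q (ij.1 + 1)) • v p μ ij.2 ◁ b _ ^ (ij.1 + 1) := by
  rw [X, ← Finset.Ico_add_one_right_eq_Icc, Finset.sum_Ico_eq_sum_range, Nat.add_sub_cancel,
    Finset.Nat.sum_antidiagonal_eq_sum_range_succ_mk]
  refine Finset.sum_congr rfl fun j hj => ?_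
  have hjn : n - j + j = n := Nat.sub_add_cancel (Nat.lt_succ_iff.1 (Finset.mem_range.1 hj))
  rw [Nat.add_comm 1 j, Nat.add_sub_cancel, Nat.add_sub_cancel, Nat.add_sub_add_right, coeffX, hjn]
  congr 1
  rw [mul_pow, div_div, mul_comm (qFact _ (n - j)), ← mul_assoc ((q - q⁻¹) ^ j)]

variable {p μ}

theorem coeffX_zero_left (hq : ¬IsOfFinOrder q) (m : ℕ) : coeffX p μ 0 m = p * μ := by
  rw [coeffX, pow_zero, one_mul, zero_add, pow_one, add_zero,
    mul_div_cancel_right₀ _ (qFact_ne_zero hq (pow_ne_zero 2 p.coe_ne_zero) m)]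

theorem coeffX_succ_left (j m : ℕ) : coeffX p μ (j + 1) m =
    (q - q⁻¹) * (p * μ) * qNum q (m + j + 1) * coeffX p μ j m := by
  rw [coeffX, coeffX, ← add_assoc, qFact_succ]
  ring

theorem coeffX_succ_right_mul_qNum (hq : ¬IsOfFinOrder q) (j m : ℕ) :
    coeffX p μ j (m + 1) * qNum q (m + 1) = coeffX p μ j m * qNum q (m + j + 1) := by
  have hm := qFact_ne_zero hq (pow_ne_zero 2 p.coe_ne_zero) m
  have hm' := qNum_ne_zero hq (pow_ne_zero 2 p.coe_ne_zero) m.succ_pos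
  rw [coeffX, coeffX, add_right_comm, qFact_succ, qFact_succ]
  field_simp

theorem upWeight_add_sub (hq : ¬IsOfFinOrder q) (m i : ℕ) :
    upWeight p μ (m + i) - (q ^ i)⁻¹ * upWeight p μ m =
      (q - q⁻¹) * (p * μ) * q ^ m * qNum q i := by
  have hq₀ : q ≠ 0 := pow_ne_zero 2 p.coe_ne_zero
  rw [mul_right_comm _ (q ^ m), mul_right_comm _ (p * μ : ℂ), sub_inv_mul_qNum hq hq₀, upWeight,
    upWeight, pow_add]
  ring

theorem shift_upWeight_v_act_b_pow (hq : ¬IsOfFinOrder q) (m i : ℕ) :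
    shift (upWeight p μ (m + i)) (v p μ m ◁ b _ ^ i) =
      (q ^ i)⁻¹ • v p μ (m + 1) ◁ b _ ^ i +
        ((q - q⁻¹) * (p * μ) * q ^ m * qNum q i) • v p μ m ◁ b _ ^ (i + 1) := by
  rw [← upWeight_add_sub hq, v_succ, shift_apply, shift_apply, act_b_pow_act_a, map_add, map_smul,
    act_act _ _ (b _), act_act _ (b _), ← pow_succ, ← pow_succ']
  module

theorem qNum_smul_X_succ (n : ℕ) : qNum q (n + 1) • X p μ (n + 1) =
    ∑ ij ∈ antidiagonal n,
      (coeffX p μ ij.1 ij.2 * qNum q (ij.2 + ij.1 + 1) / qNum q (ij.1 + 1)) •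
        v p μ ij.2 ◁ b _ ^ (ij.1 + 1) := by
  rw [X_succ_eq_sum_antidiagonal, Finset.smul_sum]
  refine Finset.sum_congr rfl fun ij hij => ?_
  rw [smul_smul, add_comm ij.2, mem_antidiagonal.1 hij]
  congr 1
  ring

theorem qNum_smul_X_succ_succ (hq : ¬IsOfFinOrder q) (n : ℕ) :
    qNum q (n + 2) • X p μ (n + 2) = shift (upWeight p μ (n + 1)) (qNum q (n + 1) • X p μ (n + 1)) +
      upWeight p μ (n + 1) • v p μ (n + 1) ◁ b _ := by
  have hqNum (j : ℕ) : qNum q (j + 1) ≠ 0 :=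
    qNum_ne_zero hq (pow_ne_zero 2 p.coe_ne_zero) j.succ_pos
  -- By `qNum_add`, each coefficient is a sum of two, to be collected along `v` and along `b`.
  have hsplit (j m : ℕ) : coeffX p μ j m * qNum q (m + j + 1) / qNum q (j + 1) =
      (q ^ (j + 1))⁻¹ * (coeffX p μ j m * qNum q m / qNum q (j + 1)) + q ^ m * coeffX p μ j m := by
    have hj := hqNum j
    rw [add_assoc, qNum_add (pow_ne_zero 2 p.coe_ne_zero)]
    field_simp
  rw [qNum_smul_X_succ]
  simp only [hsplit, add_smul, Finset.sum_add_distrib]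
  rw [Finset.Nat.sum_antidiagonal_succ', Finset.Nat.sum_antidiagonal_succ, qNum_smul_X_succ,
    map_sum, qNum_zero, mul_zero, zero_div, mul_zero, zero_smul, zero_add, zero_add, pow_one,
    coeffX_zero_left hq, ← upWeight, add_left_comm, ← Finset.sum_add_distrib, add_comm]
  congr 1
  refine Finset.sum_congr rfl ?_
  rintro ⟨j, m⟩ hjm
  have hsum : n + 1 = m + (j + 1) := by rw [← mem_antidiagonal.1 hjm, add_comm j, add_assoc]
  rw [map_smul, hsum, shift_upWeight_v_act_b_pow hq, smul_add, smul_smul, smul_smul,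
    coeffX_succ_right_mul_qNum hq, coeffX_succ_left]
  congr 2
  · ring
  · have hj := hqNum j
    field_simp

theorem dv_succ (hq : ¬IsOfFinOrder q) (n : ℕ) :
    dv p μ (n + 1) = qNum q (n + 1) • X p μ (n + 1) := by
  induction n with
  | zero =>
    rw [qNum_smul_X_succ, dv, dv, map_zero, zero_add]
    simp [coeffX_zero_left hq, upWeight, qNum_one hq (pow_ne_zero 2 p.coe_ne_zero)]
  | succ n ih => rw [dv, ih, qNum_smul_X_succ_succ hq]

theorem X_eq_smul_dv (hq : ¬IsOfFinOrder q) {n : ℕ} (hn : 0 < n) :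
    X p μ n = (qNum q n)⁻¹ • dv p μ n := by
  obtain ⟨n, rfl⟩ := Nat.exists_eq_add_one.2 hn
  rw [dv_succ hq, inv_smul_smul₀ (qNum_ne_zero hq (pow_ne_zero 2 p.coe_ne_zero) hn)]

end Expansion

theorem isSkewPrimitiveElem_X (hq : ¬IsOfFinOrder q) {n : ℕ} (hn : 0 < n) :
    IsSkewPrimitiveElem ℂ (v p μ n) (X p μ n) := by
  rw [X_eq_smul_dv hq hn]
  exact (isSkewPrimitiveElem_dv n).smul _

theorem tau_X (hq : ¬IsOfFinOrder q) {n : ℕ} (hn : 0 < n) :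
    tau p μ (μ ^ 2) (X p μ n) = -X p μ n := by
  rw [X_eq_smul_dv hq hn, LinearMap.map_smulₛₗ, tau_dv, smul_neg, map_inv₀, ← Circle.coe_pow,
    conj_qNum]

theorem X_ne_zero (hq : ¬IsOfFinOrder q) (hμ : μ ≠ 0) {n : ℕ} (hn : 0 < n) : X p μ n ≠ 0 := by
  rw [X_eq_smul_dv hq hn]
  exact smul_ne_zero (inv_ne_zero (qNum_ne_zero hq (pow_ne_zero 2 p.coe_ne_zero) hn))
    (dv_ne_zero hq hμ hn)

theorem linearIndependent_v_X (hq : ¬IsOfFinOrder q) (hμ : μ ≠ 0) :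
    LinearIndependent ℂ (Sum.elim (v p μ) fun n => X p μ (n + 1)) :=
  linearIndependent_sumElim_of_isSkewPrimitiveElem isGroupLikeElem_v (v_injective hq hμ)
    (add_left_injective 1) (fun n => isSkewPrimitiveElem_X hq n.succ_pos)
    fun n => X_ne_zero hq hμ n.succ_pos

theorem span_v_X_eq_top (hq : ¬IsOfFinOrder q) (hμ : μ ≠ 0) :
    Submodule.span ℂ (Set.range (Sum.elim (v p μ) fun n => X p μ (n + 1))) = ⊤ := by
  rw [eq_top_iff, ← tangentSpan_eq_top hq hμ, tangentSpan, Submodule.span_le, Set.Sum.elim_range]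
  rintro _ (⟨n, rfl⟩ | ⟨_ | n, rfl⟩)
  · exact Submodule.subset_span (Or.inl ⟨n, rfl⟩)
  · exact Submodule.zero_mem _
  · rw [dv_succ hq]
    exact Submodule.smul_mem _ _ (Submodule.subset_span (Or.inr ⟨n, rfl⟩))

end Rq

end

theorem mainTheorem3 (p : Circle) (hp : ∀ n : ℕ, 0 < n → (p ^ 2) ^ n ≠ 1)
    (μ : ℝ) (hμ : μ ≠ 0) :
    (∀ n : ℕ, IsGroupLikeElem ℂ (Rq.v p μ n)) ∧
    (∀ n : ℕ, 1 ≤ n → Coalgebra.comul (R := ℂ) (Rq.X p μ n) =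
      Rq.X p μ n ⊗ₜ[ℂ] Rq.v p μ n + Rq.v p μ n ⊗ₜ[ℂ] Rq.X p μ n) ∧
    (∀ n : ℕ, 1 ≤ n → CoisoK.tau p μ (μ ^ 2) (Rq.X p μ n) = -Rq.X p μ n) ∧
    LinearIndependent ℂ (Sum.elim (fun n : ℕ => Rq.v p μ n) (fun n : ℕ => Rq.X p μ (n + 1))) ∧
    Submodule.span ℂ (Set.range
      (Sum.elim (fun n : ℕ => Rq.v p μ n) (fun n : ℕ => Rq.X p μ (n + 1)))) = ⊤ := by
  have hq : ¬IsOfFinOrder ((p : ℂ) ^ 2) := by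
    rw [isOfFinOrder_iff_pow_eq_one]
    rintro ⟨n, hn, hpn⟩
    exact hp n hn (Circle.ext (mod_cast hpn))
  exact ⟨Rq.isGroupLikeElem_v, fun _ hn => Rq.isSkewPrimitiveElem_X hq hn,
    fun _ hn => Rq.tau_X hq hn, Rq.linearIndependent_v_X hq hμ, Rq.span_v_X_eq_top hq hμ⟩
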